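/- Fix $\sigma>0$ (known), an integer $q\ge 1$, a bounded function $f:[0,1]\to\mathbb R$, and a design $x_1^{(n)},\dots,x_n^{(n)}\in[0,1]$ for each $n\ge 1$. For each $n$ let $k_n$ be an integer with $q\le k_n$ for all large $n$. For such $n$ put $K=k_n+1-q$, let $B_1,\dots,B_{k_n}$ be the B-spline basis of order $q$ on $[0,1]$ relative to the partition into the intervals $((j-1)/K,j/K]$, $1\le j\le K$ (Cox–de Boor recursion, with the end knots $0$ and $1$ repeated $q$ times; the first interval is also closed at $0$), and let $\Phi=(B_j(x_i^{(n)}))_{1\le i\le n,\,1\le j\le k_n}$. The observation is $Y=F_0+\varepsilon\in\mathbb R^n$ with $F_0=(f(x_i^{(n)}))_{1\le i\le n}$ and $\varepsilon\sim\mathcal N(0,\sigma^2I_n)$; $\mathbb E$ denotes expectation under this law $\mathcal N(F_0,\sigma^2 I_n)$ of $Y$. Let $\widetilde W(d\theta\mid Y)$ be the posterior distribution of $\theta\in\mathbb R^{k_n}$ in the (possibly misspecified) model $Y\mid\theta\sim\mathcal N(\Phi\theta,\sigma^2I_n)$ with prior $\widetilde W=\mathcal N(0,I_{k_n})$. Put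 $\theta_Y=(\Phi^T\Phi)^{-1}\Phi^TY$ and $\theta_0=(\Phi^T\Phi)^{-1}\Phi^TF_0$. Assume that $k_n=o\big((n/\ln n)^{1/3}\big)$ and that there are constants $C_1,C_2>0$ such that, for all large $n$ and all $\theta\in\mathbb R^{k_n}$, $$C_1\frac n{k_n}\|\theta\|^2\le\theta^T\Phi^T\Phi\,\theta\le C_2\frac n{k_n}\|\theta\|^2 .$$ Then $$\mathbb E\big\|\widetilde W(d\theta\mid Y)-\mathcal N\big(\theta_Y,\sigma^2(\Phi^T\Phi)^{-1}\big)\big\|_{\mathrm{TV}}\to0\qquad(n\to\infty),$$ where $\|Q-Q'\|_{\mathrm{TV}}=\sup_A|Q(A)-Q'(A)|$, and the posterior convergence rate for $\theta$ in the Euclidean norm is $k_n/\sqrt n$: for every sequence $\lambda_n\to\infty$, $$\mathbb E\Big[\widetilde W\Big(\|\theta-\theta_0\|\ge\lambda_n\frac{k_n}{\sqrt n}\,\Big|\,Y\Big)\Big]\to0 .$$ -/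

import Mathlib

open MeasureTheory ProbabilityTheory Filter Topology Matrix Asymptotics
open scoped ENNReal MatrixOrder

noncomputable section

/-- The knots `t_0 ≤ t_1 ≤ …` for splines of order `q ≥ 1` on `[0, 1]`, relative to the partition
of `(0, 1]` into the `K ≥ 1` intervals `((j - 1) / K, j / K]`: the knot `0` has multiplicity `q`
(indices `0, …, q - 1`), then come `1 / K, …, (K - 1) / K`, and the knot `1` from index
`K + q - 1` on. The subtraction truncates, which gives the first `q` knots the value `0`. -/
def splineKnot (q K i : ℕ) : ℝ := (min (i + 1 - q) K : ℕ) / (K : ℝ)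

/-- The B-splines of degree `d` (order `d + 1`) of a nondecreasing knot sequence `t`, by the
Cox-de Boor recursion, with the usual convention that a term with denominator `0` vanishes.
The intervals are `(t_j, t_{j+1}]`, the first nonempty one being closed on the left as well. -/
def bSpline (t : ℕ → ℝ) : ℕ → ℕ → ℝ → ℝ
  | 0, j, x =>
      open Classical in
      if t j < t (j + 1) ∧ (t j < x ∨ (x = t 0 ∧ t j = t 0)) ∧ x ≤ t (j + 1) then 1 else 0
  | d + 1, j, x =>
      (x - t j) / (t (j + d + 1) - t j) * bSpline t d j x
        + (t (j + d + 2) - x) / (t (j + d + 2) - t (j + 1)) * bSpline t d (j + 1) x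

/-- The matrix `Φ = (B_j(x_i))` of the `k` B-splines of order `q` on the partition of `(0, 1]` into
`K = k + 1 - q` intervals of equal length (here `1 ≤ q ≤ k`), evaluated at the design points. -/
def splineMatrix (q k : ℕ) {n : ℕ} (x : Fin n → unitInterval) : Matrix (Fin n) (Fin k) ℝ :=
  Matrix.of fun i j => bSpline (splineKnot q (k + 1 - q)) (q - 1) j (x i)

/-- The least squares coefficients `(Φᵀ Φ)⁻¹ Φᵀ y`. -/
def lsCoeff {n k : ℕ} (Φ : Matrix (Fin n) (Fin k) ℝ) (y : EuclideanSpace ℝ (Fin n)) :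
    EuclideanSpace ℝ (Fin k) :=
  WithLp.toLp 2 ((Φᵀ * Φ)⁻¹ *ᵥ (Φᵀ *ᵥ y.ofLp))

/-- The normal distribution `N(m, σ² I_n)`. -/
abbrev isoGaussian {n : ℕ} (m : EuclideanSpace ℝ (Fin n)) (σ : ℝ) :
    Measure (EuclideanSpace ℝ (Fin n)) :=
  multivariateGaussian m ((σ ^ 2) • (1 : Matrix (Fin n) (Fin n) ℝ))

/-- The Gaussian linear regression model: given `θ`, the observation is `N(Φ θ, σ² I_n)`. -/
def regressionKernel {n k : ℕ} (Φ : Matrix (Fin n) (Fin k) ℝ) (σ : ℝ) :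
    Kernel (EuclideanSpace ℝ (Fin k)) (EuclideanSpace ℝ (Fin n)) where
  toFun θ := isoGaussian (WithLp.toLp 2 (Φ *ᵥ θ.ofLp)) σ
  measurable' := by
    refine Measure.measurable_of_measurable_coe _ fun s hs => ?_
    have hm : Measurable fun p : EuclideanSpace ℝ (Fin k) × EuclideanSpace ℝ (Fin n) =>
        WithLp.toLp 2 (Φ *ᵥ p.1.ofLp) + Matrix.toEuclideanCLM (𝕜 := ℝ)
          (CFC.sqrt ((σ ^ 2) • (1 : Matrix (Fin n) (Fin n) ℝ))) p.2 := by
      have h1 : Continuous fun p : EuclideanSpace ℝ (Fin k) × EuclideanSpace ℝ (Fin n) =>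
          WithLp.toLp 2 (Φ *ᵥ p.1.ofLp) := by fun_prop
      exact (h1.add (by fun_prop)).measurable
    have h2 := measurable_measure_prodMk_left
      (ν := stdGaussian (EuclideanSpace ℝ (Fin n))) (hm hs)
    convert h2 using 2 with θ
    rw [isoGaussian, multivariateGaussian, Measure.map_apply (by fun_prop) hs]
    rfl

instance {n k : ℕ} (Φ : Matrix (Fin n) (Fin k) ℝ) (σ : ℝ) :
    IsMarkovKernel (regressionKernel Φ σ) where
  isProbabilityMeasure θ :=
    inferInstanceAs (IsProbabilityMeasure (isoGaussian (WithLp.toLp 2 (Φ *ᵥ θ.ofLp)) σ))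

/-- The posterior distribution of `θ` for the prior `N(0, I_k)` in the model
`Y | θ ∼ N(Φ θ, σ² I_n)`, as a kernel from the observations to the parameters. -/
def coeffPosterior {n k : ℕ} (Φ : Matrix (Fin n) (Fin k) ℝ) (σ : ℝ) :
    Kernel (EuclideanSpace ℝ (Fin n)) (EuclideanSpace ℝ (Fin k)) :=
  posterior (regressionKernel Φ σ)
    (multivariateGaussian (0 : EuclideanSpace ℝ (Fin k)) (1 : Matrix (Fin k) (Fin k) ℝ))

/-- The total variation distance `sup_A |μ(A) - ν(A)|` of two probability measures. -/
def tvDist {α : Type*} [MeasurableSpace α] (μ ν : Measure α) : ℝ≥0∞ :=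
  ⨆ (A : Set α) (_ : MeasurableSet A), ENNReal.ofReal |μ.real A - ν.real A|

end

/-! By Bayes' formula and Pythagoras, the posterior is almost surely `N(θ_Y, S)`, `S = σ² (Φᵀ Φ)⁻¹`,
reweighted by the prior density `exp (-‖θ‖² / 2)` (`coeffPosterior_ae_eq_tilted`). So no local
expansion is needed: it suffices that the prior is nearly constant on the scale of this Gaussian. Up
to a constant, the potential is `u = ⟪θ_Y, θ - θ_Y⟫ + ‖θ - θ_Y‖² / 2`, and tilting by `-u` costs at
most `∫ |u| + log ∫ exp (-u)` in total variation (`tvDist_tilted_le`). Both terms are controlled by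
`tr S` and `θ_Yᵀ S θ_Y`. If `Φᵀ Φ ≥ c` with `c = C₁ n / k`, then `tr S ≤ σ² k / c` and `θ_Yᵀ S θ_Y ≤
σ² ‖Y‖² / c²`. As `E ‖Y‖² = O(n)` for bounded `f`, both are `O(k² / n)` in mean, and `k / √n → 0`.
The rate follows from Chebyshev's inequality for the Gaussian, plus the total variation error. -/

/-! ### Exponential tilting under shifts, scalings and changes of variables -/

section TiltedMeasure

variable {α β : Type*} [MeasurableSpace α] [MeasurableSpace β]

theorem tilted_add_const (μ : Measure α) (f : α → ℝ) (c : ℝ) :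
    μ.tilted (fun x => f x + c) = μ.tilted f := by
  unfold Measure.tilted
  congr 1 with x
  simp_rw [Real.exp_add, integral_mul_const]
  rw [mul_div_mul_right _ _ (Real.exp_pos c).ne']

theorem tilted_smul_measure (μ : Measure α) (f : α → ℝ) {c : ℝ≥0∞} (h0 : c ≠ 0) (ht : c ≠ ∞) :
    (c • μ).tilted f = μ.tilted f := by
  unfold Measure.tilted
  have hc : 0 < c.toReal := ENNReal.toReal_pos h0 ht
  have h : (fun x => ENNReal.ofReal (Real.exp (f x) / ∫ x, Real.exp (f x) ∂μ))
      = c • fun x => ENNReal.ofReal (Real.exp (f x) / ∫ x, Real.exp (f x) ∂(c • μ)) := by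
    ext x
    rw [integral_smul_measure, Pi.smul_apply, smul_eq_mul, smul_eq_mul]
    obtain ⟨r, hr⟩ : ∃ r, r = c.toReal := ⟨_, rfl⟩
    rw [← ENNReal.ofReal_toReal ht, ← hr, ENNReal.toReal_ofReal (hr ▸ hc.le),
      ← ENNReal.ofReal_mul (hr ▸ hc.le)]
    congr 1
    rw [← hr] at hc
    field_simp
  rw [withDensity_smul_measure, h, withDensity_smul' _ _ ht]

theorem tilted_map_equiv (μ : Measure α) (e : α ≃ᵐ β) (g : β → ℝ) :
    (μ.map e).tilted g = (μ.tilted (g ∘ e)).map e := by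
  ext s hs
  rw [tilted_apply' _ _ hs, e.map_apply, tilted_apply' _ _ (e.measurable hs),
    e.restrict_map, lintegral_map_equiv, integral_map_equiv]
  rfl

end TiltedMeasure

/-! ### Lebesgue densities of Gaussian measures -/

section GaussianDensity

theorem integrable_exp_neg_half_norm_sq (E : Type*) [NormedAddCommGroup E] [InnerProductSpace ℝ E]
    [FiniteDimensional ℝ E] [MeasurableSpace E] [BorelSpace E] :
    Integrable (fun x : E => Real.exp (-‖x‖ ^ 2 / 2)) := by
  have h := GaussianFourier.integrable_cexp_neg_mul_sq_norm_add (V := E) (b := 1 / 2)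
    (by norm_num) 0 0
  refine h.re.congr (ae_of_all _ fun x => ?_)
  have : (-(1 / 2) * (‖x‖ : ℂ) ^ 2 + 0 * (inner ℝ (0 : E) x : ℝ)) = ((-‖x‖ ^ 2 / 2 : ℝ) : ℂ) := by
    push_cast; ring
  simp only [this, ← Complex.ofReal_exp]
  rfl

/-- The standard Gaussian measure has the density `exp (-‖x‖² / 2)`, up to normalisation. -/
theorem stdGaussian_eq_tilted (E : Type*) [NormedAddCommGroup E] [InnerProductSpace ℝ E]
    [FiniteDimensional ℝ E] [MeasurableSpace E] [BorelSpace E] :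
    stdGaussian E = (volume : Measure E).tilted (fun x => -‖x‖ ^ 2 / 2) := by
  have hi := integrable_exp_neg_half_norm_sq E
  have : IsProbabilityMeasure ((volume : Measure E).tilted (fun x => -‖x‖ ^ 2 / 2)) :=
    isProbabilityMeasure_tilted hi
  -- The characteristic function of the tilted measure is a quotient of two Gaussian integrals, with
  -- linear terms `I * ⟪t, x⟫` and `0`. Their common power of `2π` cancels.
  refine Measure.ext_of_charFun ?_
  ext t
  rw [charFun_stdGaussian, charFun_apply, integral_tilted]
  set Z : ℝ := ∫ x : E, Real.exp (-‖x‖ ^ 2 / 2) with hZ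
  have hZ0 : (Z : ℂ) ≠ 0 := by exact_mod_cast (integral_exp_pos hi).ne'
  have h0 := GaussianFourier.integral_cexp_neg_mul_sq_norm_add (V := E) (b := 1 / 2)
    (by norm_num) 0 0
  have h1 := GaussianFourier.integral_cexp_neg_mul_sq_norm_add (V := E) (b := 1 / 2)
    (by norm_num) Complex.I t
  have hZ1 : (Z : ℂ) = (Real.pi / (1 / 2) : ℂ) ^ ((Module.finrank ℝ E : ℂ) / 2) := by
    have h2 : (Real.pi / (1 / 2) : ℂ) ^ ((Module.finrank ℝ E : ℂ) / 2)
        = ∫ v : E, Complex.exp (-(1 / 2) * (‖v‖ : ℂ) ^ 2 + 0 * (inner ℝ (0 : E) v : ℝ)) := by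
      rw [h0]; simp
    rw [h2, hZ, ← integral_complex_ofReal]
    congr 1 with x
    push_cast
    congr 1
    ring
  have h3 : ∀ x : E, (Real.exp (-‖x‖ ^ 2 / 2) / Z) • Complex.exp ((inner ℝ x t : ℝ) * Complex.I)
      = (Z : ℂ)⁻¹ * Complex.exp (-(1 / 2) * (‖x‖ : ℂ) ^ 2 + Complex.I * (inner ℝ t x : ℝ)) := by
    intro x
    rw [Complex.exp_add, Complex.real_smul, real_inner_comm]
    push_cast
    rw [mul_comm Complex.I]
    have : (-(‖x‖ : ℂ) ^ 2 / 2) = -(1 / 2) * (‖x‖ : ℂ) ^ 2 := by ring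
    rw [this]
    ring
  simp_rw [h3]
  rw [integral_const_mul, h1, ← hZ1, inv_mul_cancel_left₀ hZ0]
  congr 1
  rw [Complex.I_sq]
  ring

variable {ι : Type*} [Fintype ι] [DecidableEq ι]

theorem inner_toEuclideanCLM_symm {A : Matrix ι ι ℝ} (hA : Aᵀ = A) (x y : EuclideanSpace ℝ ι) :
    inner ℝ (toEuclideanCLM (𝕜 := ℝ) A x) y = inner ℝ x (toEuclideanCLM (𝕜 := ℝ) A y) := by
  simp only [EuclideanSpace.inner_eq_star_dotProduct, ofLp_toEuclideanCLM, star_trivial]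
  rw [dotProduct_mulVec, ← mulVec_transpose, hA, dotProduct_comm]

/-- The density of a nondegenerate multivariate Gaussian measure, up to normalisation. -/
theorem multivariateGaussian_eq_tilted (m : EuclideanSpace ℝ ι) {S : Matrix ι ι ℝ}
    (hS : S.PosDef) :
    Integrable (fun z : EuclideanSpace ℝ ι =>
      Real.exp (-((z - m).ofLp ⬝ᵥ (S⁻¹ *ᵥ (z - m).ofLp)) / 2)) ∧
    multivariateGaussian m S = (volume : Measure (EuclideanSpace ℝ ι)).tilted
      (fun z => -((z - m).ofLp ⬝ᵥ (S⁻¹ *ᵥ (z - m).ofLp)) / 2) := by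
  -- The law is the image of the standard Gaussian under `x ↦ m + A x`. This map turns the quadratic
  -- form of `S⁻¹` into `‖x‖²`, and its constant Jacobian disappears in the normalisation.
  set A := CFC.sqrt S with hAdef
  have hAA : A * A = S := CFC.sqrt_mul_sqrt_self S hS.posSemidef.nonneg
  have hAT : Aᵀ = A := by
    have h : A.PosSemidef := Matrix.nonneg_iff_posSemidef.1 (CFC.sqrt_nonneg S)
    simpa using h.isHermitian.eq
  have hdet : IsUnit A.det := by
    have h : A.det * A.det = S.det := by rw [← det_mul, hAA]
    have : A.det ≠ 0 := fun h0 => hS.det_pos.ne' (by rw [← h, h0, zero_mul])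
    exact this.isUnit
  have h1 : A⁻¹ * A = 1 := nonsing_inv_mul A hdet
  have h2 : A * A⁻¹ = 1 := mul_nonsing_inv A hdet
  have hinv : S⁻¹ = A⁻¹ * A⁻¹ := by rw [← hAA, Matrix.mul_inv_rev]
  have hq : ∀ z : EuclideanSpace ℝ ι,
      z.ofLp ⬝ᵥ (S⁻¹ *ᵥ z.ofLp) = ‖toEuclideanCLM (𝕜 := ℝ) A⁻¹ z‖ ^ 2 := by
    intro z
    rw [← real_inner_self_eq_norm_sq, inner_toEuclideanCLM_symm (by rw [transpose_nonsing_inv, hAT]),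
      ← mul_apply_eq_comp, ← map_mul, ← hinv, inner_toEuclideanCLM]
  let T : EuclideanSpace ℝ ι ≃L[ℝ] EuclideanSpace ℝ ι :=
    ContinuousLinearEquiv.equivOfInverse (toEuclideanCLM (𝕜 := ℝ) A) (toEuclideanCLM (𝕜 := ℝ) A⁻¹)
      (fun x => by rw [← mul_apply_eq_comp, ← map_mul, h1]; simp)
      (fun x => by rw [← mul_apply_eq_comp, ← map_mul, h2]; simp)
  have hTs : ∀ z, T.symm z = toEuclideanCLM (𝕜 := ℝ) A⁻¹ z := fun z => rfl
  let e : EuclideanSpace ℝ ι ≃ᵐ EuclideanSpace ℝ ι :=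
    T.toHomeomorph.toMeasurableEquiv.trans (Homeomorph.addLeft m).toMeasurableEquiv
  have he : ∀ x, e x = m + T x := fun x => rfl
  have hdetT : LinearMap.det (T : EuclideanSpace ℝ ι →ₗ[ℝ] EuclideanSpace ℝ ι) ≠ 0 :=
    (LinearEquiv.isUnit_det' T.toLinearEquiv).ne_zero
  obtain ⟨c, hc0, hct, hvol⟩ : ∃ c : ℝ≥0∞, c ≠ 0 ∧ c ≠ ∞ ∧
      (volume : Measure (EuclideanSpace ℝ ι)).map e = c • volume := by
    refine ⟨ENNReal.ofReal |(LinearMap.det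
      (T : EuclideanSpace ℝ ι →ₗ[ℝ] EuclideanSpace ℝ ι))⁻¹|, ?_, by simp, ?_⟩
    · simpa using hdetT
    · have : (e : EuclideanSpace ℝ ι → EuclideanSpace ℝ ι) = (fun x => m + x) ∘
          (T : EuclideanSpace ℝ ι →ₗ[ℝ] EuclideanSpace ℝ ι) := rfl
      have hT : Measurable (T : EuclideanSpace ℝ ι →ₗ[ℝ] EuclideanSpace ℝ ι) :=
        T.continuous.measurable
      rw [this, ← Measure.map_map (measurable_const_add m) hT,
        Measure.map_linearMap_addHaar_eq_smul_addHaar _ hdetT, Measure.map_smul,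
        map_add_left_eq_self]
  have hcomp : (fun z : EuclideanSpace ℝ ι => -((z - m).ofLp ⬝ᵥ (S⁻¹ *ᵥ (z - m).ofLp)) / 2) ∘ e
      = fun x => -‖x‖ ^ 2 / 2 := by
    ext x
    simp only [Function.comp_apply, hq, he, ← hTs, add_sub_cancel_left,
      ContinuousLinearEquiv.symm_apply_apply]
  have hm : multivariateGaussian m S = (stdGaussian (EuclideanSpace ℝ ι)).map e := rfl
  constructor
  · have := integrable_exp_neg_half_norm_sq (EuclideanSpace ℝ ι)
    have h3 : Integrable (fun z : EuclideanSpace ℝ ι =>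
        Real.exp (-((z - m).ofLp ⬝ᵥ (S⁻¹ *ᵥ (z - m).ofLp)) / 2)) (c • volume) := by
      rw [← hvol, integrable_map_equiv]
      refine this.congr (ae_of_all _ fun x => ?_)
      have := congrFun hcomp x
      simp only [Function.comp_apply] at this ⊢
      rw [this]
    exact (integrable_smul_measure hc0 hct).1 h3
  · rw [hm, stdGaussian_eq_tilted, ← hcomp, ← tilted_map_equiv, hvol,
      tilted_smul_measure _ _ hc0 hct]

end GaussianDensity

/-! ### Second moments and exponential moments of Gaussian vectors -/

section GaussianMoments

variable {ι : Type*} [Fintype ι] [DecidableEq ι] {S : Matrix ι ι ℝ}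

theorem integral_inner_sub_mean_sq (m : EuclideanSpace ℝ ι) (hS : S.PosSemidef)
    (a : EuclideanSpace ℝ ι) :
    ∫ x, (inner ℝ a (x - m)) ^ 2 ∂(multivariateGaussian m S) = a.ofLp ⬝ᵥ (S *ᵥ a.ofLp) := by
  rw [← covarianceBilin_multivariateGaussian (μ := m) hS, covarianceBilin_self IsGaussian.memLp_two_id,
    variance_eq_integral (by fun_prop)]
  congr 1 with x
  have h : ∫ x, inner ℝ a x ∂(multivariateGaussian m S) = inner ℝ a m := by
    have h := ContinuousLinearMap.integral_comp_id_comm (μ := multivariateGaussian m S)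
      IsGaussian.integrable_id (innerSL ℝ a)
    simpa using h
  rw [h, inner_sub_right]

theorem integrable_inner_sub_sq (m b : EuclideanSpace ℝ ι) (a : EuclideanSpace ℝ ι) :
    Integrable (fun x => (inner ℝ a (x - b)) ^ 2) (multivariateGaussian m S) := by
  have h : MemLp (fun x : EuclideanSpace ℝ ι => x - b) 2 (multivariateGaussian m S) :=
    IsGaussian.memLp_two_id.sub (memLp_const b)
  exact (h.const_inner a).integrable_sq

theorem integrable_norm_sub_sq (m b : EuclideanSpace ℝ ι) :
    Integrable (fun x => ‖x - b‖ ^ 2) (multivariateGaussian m S) := by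
  have h : MemLp (fun x : EuclideanSpace ℝ ι => x - b) 2 (multivariateGaussian m S) :=
    IsGaussian.memLp_two_id.sub (memLp_const b)
  exact h.norm.integrable_sq

theorem integral_norm_sub_mean_sq (m : EuclideanSpace ℝ ι) (hS : S.PosSemidef) :
    ∫ x, ‖x - m‖ ^ 2 ∂(multivariateGaussian m S) = S.trace := by
  have h : ∀ x : EuclideanSpace ℝ ι, ‖x - m‖ ^ 2
      = ∑ i, (inner ℝ (EuclideanSpace.single i (1 : ℝ)) (x - m)) ^ 2 := by
    intro x
    rw [EuclideanSpace.real_norm_sq_eq]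
    simp [EuclideanSpace.inner_single_left]
  simp_rw [h]
  rw [integral_finsetSum _ fun i _ => integrable_inner_sub_sq m m _]
  simp_rw [integral_inner_sub_mean_sq m hS]
  simp [Matrix.trace]

theorem integral_exp_neg_inner_sub_mean (m : EuclideanSpace ℝ ι) (hS : S.PosSemidef)
    (a : EuclideanSpace ℝ ι) :
    Integrable (fun x => Real.exp (-inner ℝ a (x - m))) (multivariateGaussian m S) ∧
    ∫ x, Real.exp (-inner ℝ a (x - m)) ∂(multivariateGaussian m S)
      = Real.exp (a.ofLp ⬝ᵥ (S *ᵥ a.ofLp) / 2) := by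
  have hv : Var[innerSL ℝ a; multivariateGaussian m S] = a.ofLp ⬝ᵥ (S *ᵥ a.ofLp) := by
    rw [← covarianceBilin_multivariateGaussian (μ := m) hS,
      covarianceBilin_self IsGaussian.memLp_two_id]
    rfl
  have hmean : ∫ x, innerSL ℝ a x ∂(multivariateGaussian m S) = inner ℝ a m := by
    have h := ContinuousLinearMap.integral_comp_id_comm (μ := multivariateGaussian m S)
      IsGaussian.integrable_id (innerSL ℝ a)
    simpa using h
  have hmap := IsGaussian.map_eq_gaussianReal (μ := multivariateGaussian m S) (innerSL ℝ a)
  rw [hmean] at hmap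
  have hmgf := mgf_gaussianReal hmap (-1)
  have hnn : 0 ≤ a.ofLp ⬝ᵥ (S *ᵥ a.ofLp) := by rw [← hv]; exact variance_nonneg _ _
  rw [hv, Real.coe_toNNReal _ hnn] at hmgf
  have hfun : ∀ x : EuclideanSpace ℝ ι, Real.exp (-inner ℝ a (x - m))
      = Real.exp (inner ℝ a m) * Real.exp (-1 * innerSL ℝ a x) := by
    intro x
    rw [← Real.exp_add, inner_sub_right, innerSL_apply_apply]
    ring_nf
  -- Without integrability the moment generating function would take the default value `0`, but it
  -- equals an exponential.
  have hint : Integrable (fun x => Real.exp (-1 * innerSL ℝ a x)) (multivariateGaussian m S) := by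
    by_contra hni
    have := mgf_undef hni
    rw [hmgf] at this
    exact (Real.exp_pos _).ne' this
  refine ⟨by simp_rw [hfun]; exact hint.const_mul _, ?_⟩
  simp_rw [hfun]
  rw [integral_const_mul]
  change _ * mgf (innerSL ℝ a) (multivariateGaussian m S) (-1) = _
  rw [hmgf, ← Real.exp_add]
  ring_nf

end GaussianMoments

/-! ### Bayes' formula for dominated models -/

section Bayes

/-- A null set of the mixture is null for at least one `κ θ`. This carries statements that hold
almost surely under the marginal of the model over to the true, possibly misspecified, law of the
observation. -/
theorem absolutelyContinuous_comp_of_forall {Ω 𝓧 : Type*} [MeasurableSpace Ω]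
    [MeasurableSpace 𝓧] {κ : Kernel Ω 𝓧} {μ : Measure Ω} [NeZero μ]
    {l : Measure 𝓧} (h : ∀ θ, l ≪ κ θ) : l ≪ κ ∘ₘ μ := by
  refine Measure.AbsolutelyContinuous.mk fun s hs h0 => ?_
  rw [Measure.bind_apply hs κ.aemeasurable,
    lintegral_eq_zero_iff (κ.measurable_coe hs)] at h0
  obtain ⟨θ, hθ⟩ := h0.exists
  exact h θ hθ

variable {Ω 𝓧 : Type*} [MeasurableSpace Ω] [MeasurableSpace 𝓧] [StandardBorelSpace Ω] [Nonempty Ω]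

/-- **Bayes' formula** for a dominated model with a bounded likelihood `exp (g θ y)`. -/
theorem posterior_ae_eq_tilted (κ : Kernel Ω 𝓧) [IsMarkovKernel κ] (μ : Measure Ω)
    [IsProbabilityMeasure μ] (l : Measure 𝓧) [SFinite l] (g : Ω → 𝓧 → ℝ)
    (hg : Measurable fun p : Ω × 𝓧 => g p.1 p.2) (hg0 : ∀ θ y, g θ y ≤ 0)
    (hκ : ∀ θ, κ θ = l.withDensity fun y => ENNReal.ofReal (Real.exp (g θ y))) :
    ∀ᵐ y ∂(κ ∘ₘ μ), posterior κ μ y = μ.tilted fun θ => g θ y := by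
  have hgy : ∀ y, Measurable fun θ => g θ y := fun y => hg.comp measurable_prodMk_right
  have hgθ : ∀ θ, Measurable fun y => g θ y := fun θ => hg.comp measurable_prodMk_left
  have hint : ∀ y, Integrable (fun θ => Real.exp (g θ y)) μ := fun y =>
    Integrable.of_bound (hgy y).exp.aestronglyMeasurable 1 (ae_of_all _ fun θ => by
      simpa using hg0 θ y)
  set Z : 𝓧 → ℝ := fun y => ∫ θ, Real.exp (g θ y) ∂μ with hZ
  have hZpos : ∀ y, 0 < Z y := fun y => integral_exp_pos (hint y)
  have hg' : Measurable fun p : 𝓧 × Ω => g p.2 p.1 := hg.comp measurable_swap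
  have hZm : Measurable Z :=
    (hg'.exp.stronglyMeasurable.integral_prod_right (ν := μ)).measurable
  have hdm : Measurable (Function.uncurry fun y θ => ENNReal.ofReal (Real.exp (g θ y) / Z y)) :=
    (hg'.exp.div (hZm.comp measurable_fst)).ennreal_ofReal
  let η : Kernel 𝓧 Ω := Kernel.withDensity (Kernel.const 𝓧 μ)
    fun y θ => ENNReal.ofReal (Real.exp (g θ y) / Z y)
  have hη : ∀ y, η y = μ.tilted fun θ => g θ y := fun y => by
    rw [Kernel.withDensity_apply _ hdm, Kernel.const_apply]; rfl
  have : IsMarkovKernel η := ⟨fun y => by rw [hη]; exact isProbabilityMeasure_tilted (hint y)⟩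
  -- The posterior is determined almost everywhere by the joint law. After Tonelli, the identity
  -- reduces for each `y` to the cancellation of the evidence `Z y`.
  suffices h : (κ ∘ₘ μ) ⊗ₘ η = (μ ⊗ₘ κ).map Prod.swap by
    filter_upwards [ae_eq_posterior_of_compProd_eq h] with y hy
    rw [← hy, hη]
  refine Measure.ext_of_lintegral _ fun F hF => ?_
  have hFy : ∀ y, Measurable fun θ => F (y, θ) := fun y => hF.comp measurable_prodMk_left
  have hFθ : ∀ θ, Measurable fun y => F (y, θ) := fun θ => hF.comp measurable_prodMk_right
  have hH : Measurable fun y => ∫⁻ θ, F (y, θ) ∂(η y) := hF.lintegral_kernel_prod_right'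
  rw [Measure.lintegral_compProd hF, Measure.lintegral_bind κ.aemeasurable hH.aemeasurable,
    lintegral_map hF measurable_swap, Measure.lintegral_compProd (f := fun p => F p.swap) (hF.comp measurable_swap)]
  have h1 : ∀ θ, ∫⁻ y, ∫⁻ θ', F (y, θ') ∂(η y) ∂(κ θ)
      = ∫⁻ y, ENNReal.ofReal (Real.exp (g θ y)) * ∫⁻ θ', F (y, θ') ∂(η y) ∂l := fun θ => by
    rw [hκ, lintegral_withDensity_eq_lintegral_mul _ (hgθ θ).exp.ennreal_ofReal hH]
    rfl
  have h2 : ∀ θ, ∫⁻ y, F (Prod.swap (θ, y)) ∂(κ θ)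
      = ∫⁻ y, ENNReal.ofReal (Real.exp (g θ y)) * F (y, θ) ∂l := fun θ => by
    rw [hκ, lintegral_withDensity_eq_lintegral_mul _ (hgθ θ).exp.ennreal_ofReal
      (g := fun y => F (Prod.swap (θ, y))) (hFθ θ)]
    rfl
  simp_rw [h1, h2]
  have hs1 : AEMeasurable (Function.uncurry fun θ y =>
      ENNReal.ofReal (Real.exp (g θ y)) * ∫⁻ θ', F (y, θ') ∂(η y)) (μ.prod l) :=
    (hg.exp.ennreal_ofReal.mul (hH.comp measurable_snd)).aemeasurable
  have hs2 : AEMeasurable (Function.uncurry fun θ y =>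
      ENNReal.ofReal (Real.exp (g θ y)) * F (y, θ)) (μ.prod l) :=
    (hg.exp.ennreal_ofReal.mul (hF.comp measurable_swap)).aemeasurable
  rw [lintegral_lintegral_swap hs1, lintegral_lintegral_swap hs2]
  refine lintegral_congr fun y => ?_
  rw [lintegral_mul_const _ (hgy y).exp.ennreal_ofReal, hη, lintegral_tilted,
    ← ofReal_integral_eq_lintegral_ofReal (hint y) (ae_of_all _ fun θ => (Real.exp_pos _).le),
    ← lintegral_const_mul]
  · refine lintegral_congr fun θ => ?_
    rw [← mul_assoc, ← ENNReal.ofReal_mul (hZpos y).le]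
    congr 2
    exact mul_div_cancel₀ _ (hZpos y).ne'
  · exact ((hgy y).exp.div_const _).ennreal_ofReal.mul (hFy y)

end Bayes

/-! ### The posterior in the Gaussian linear model -/

section Regression

theorem norm_sq_eq_dotProduct {ι : Type*} [Fintype ι] (x : EuclideanSpace ℝ ι) :
    ‖x‖ ^ 2 = x.ofLp ⬝ᵥ x.ofLp := by
  rw [EuclideanSpace.real_norm_sq_eq, dotProduct]
  simp_rw [sq]

theorem posDef_smul_one {n : ℕ} {σ : ℝ} (hσ : 0 < σ) :
    ((σ ^ 2) • (1 : Matrix (Fin n) (Fin n) ℝ)).PosDef :=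
  Matrix.PosDef.one.smul (by positivity)

theorem isoGaussian_eq_tilted {n : ℕ} (m : EuclideanSpace ℝ (Fin n)) {σ : ℝ} (hσ : 0 < σ) :
    Integrable (fun y : EuclideanSpace ℝ (Fin n) => Real.exp (-‖y - m‖ ^ 2 / (2 * σ ^ 2))) ∧
    isoGaussian m σ = (volume : Measure (EuclideanSpace ℝ (Fin n))).tilted
      (fun y => -‖y - m‖ ^ 2 / (2 * σ ^ 2)) := by
  have hinv : ((σ ^ 2) • (1 : Matrix (Fin n) (Fin n) ℝ))⁻¹ = (σ ^ 2)⁻¹ • 1 := by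
    refine Matrix.inv_eq_left_inv ?_
    rw [Matrix.smul_mul, Matrix.one_mul, smul_smul, inv_mul_cancel₀ (by positivity), one_smul]
  have h : (fun y : EuclideanSpace ℝ (Fin n) => -((y - m).ofLp ⬝ᵥ
      (((σ ^ 2) • (1 : Matrix (Fin n) (Fin n) ℝ))⁻¹ *ᵥ (y - m).ofLp)) / 2)
      = fun y => -‖y - m‖ ^ 2 / (2 * σ ^ 2) := by
    ext y
    rw [hinv, smul_mulVec, one_mulVec, dotProduct_smul, norm_sq_eq_dotProduct, smul_eq_mul]
    field_simp
  have := multivariateGaussian_eq_tilted m (posDef_smul_one (n := n) hσ)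
  exact ⟨this.1.congr (ae_of_all _ fun y => congrArg Real.exp (congrFun h y)),
    by rw [← h]; exact this.2⟩

variable {n k : ℕ} {Φ : Matrix (Fin n) (Fin k) ℝ} {σ : ℝ}

/-- Pythagoras: by the normal equations, the least squares residual is orthogonal to the range of
`Φ`. -/
theorem sq_norm_sub_mulVec (hG : IsUnit (Φᵀ * Φ).det) (y : EuclideanSpace ℝ (Fin n))
    (θ : EuclideanSpace ℝ (Fin k)) :
    ‖y - WithLp.toLp 2 (Φ *ᵥ θ.ofLp)‖ ^ 2
      = (θ - lsCoeff Φ y).ofLp ⬝ᵥ ((Φᵀ * Φ) *ᵥ (θ - lsCoeff Φ y).ofLp)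
        + ‖y - WithLp.toLp 2 (Φ *ᵥ (lsCoeff Φ y).ofLp)‖ ^ 2 := by
  obtain ⟨t, ht⟩ : ∃ t, lsCoeff Φ y = t := ⟨_, rfl⟩
  have h0 : Φᵀ *ᵥ (Φ *ᵥ t.ofLp) = Φᵀ *ᵥ y.ofLp := by
    rw [← ht, lsCoeff, mulVec_mulVec, mulVec_mulVec, mul_nonsing_inv _ hG, one_mulVec]
  have key : ∀ v : Fin k → ℝ, (Φ *ᵥ v) ⬝ᵥ (y.ofLp - Φ *ᵥ t.ofLp) = 0 := fun v => by
    rw [dotProduct_comm, dotProduct_mulVec, ← mulVec_transpose, mulVec_sub, h0, sub_self,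
      zero_dotProduct]
  have h1 : y.ofLp - Φ *ᵥ θ.ofLp = (y.ofLp - Φ *ᵥ t.ofLp) - Φ *ᵥ (θ.ofLp - t.ofLp) := by
    rw [mulVec_sub]; abel
  rw [ht, norm_sq_eq_dotProduct, norm_sq_eq_dotProduct, WithLp.ofLp_sub, WithLp.ofLp_sub,
    WithLp.ofLp_sub, h1]
  rw [← mulVec_mulVec, dotProduct_mulVec (θ.ofLp - t.ofLp) Φᵀ, vecMul_transpose]
  have h2 := key (θ.ofLp - t.ofLp)
  generalize Φ *ᵥ (θ.ofLp - t.ofLp) = b at h2 ⊢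
  generalize y.ofLp - Φ *ᵥ t.ofLp = a at h2 ⊢
  rw [sub_dotProduct, dotProduct_sub, dotProduct_sub, h2, dotProduct_comm a b, h2]
  ring

/-- The posterior is the normal law of the least squares estimator, tilted by the prior density. -/
theorem coeffPosterior_ae_eq_tilted (hσ : 0 < σ) (hG : (Φᵀ * Φ).PosDef)
    (m : EuclideanSpace ℝ (Fin n)) :
    ∀ᵐ y ∂(isoGaussian m σ), coeffPosterior Φ σ y
      = (multivariateGaussian (lsCoeff Φ y) ((σ ^ 2) • (Φᵀ * Φ)⁻¹)).tilted
          fun θ => -‖θ‖ ^ 2 / 2 := by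
  let g : EuclideanSpace ℝ (Fin k) → EuclideanSpace ℝ (Fin n) → ℝ :=
    fun θ y => -‖y - WithLp.toLp 2 (Φ *ᵥ θ.ofLp)‖ ^ 2 / (2 * σ ^ 2)
  have hgm : Measurable fun p : EuclideanSpace ℝ (Fin k) × EuclideanSpace ℝ (Fin n) =>
      g p.1 p.2 := by
    have : Continuous fun p : EuclideanSpace ℝ (Fin k) × EuclideanSpace ℝ (Fin n) =>
      g p.1 p.2 := by fun_prop
    exact this.measurable
  have hg0 : ∀ θ y, g θ y ≤ 0 := fun θ y => by
    simp only [g]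
    rw [neg_div]
    have : 0 ≤ ‖y - WithLp.toLp 2 (Φ *ᵥ θ.ofLp)‖ ^ 2 / (2 * σ ^ 2) := by positivity
    linarith
  let Z : ℝ := ∫ y : EuclideanSpace ℝ (Fin n), Real.exp (-‖y‖ ^ 2 / (2 * σ ^ 2))
  have hZ : 0 < Z := by
    have := (isoGaussian_eq_tilted (0 : EuclideanSpace ℝ (Fin n)) hσ).1
    simp only [sub_zero] at this
    exact integral_exp_pos this
  -- By translation invariance the normalising constant does not depend on `θ`. Moving it into the
  -- dominating measure leaves a likelihood `exp (g θ y) ≤ 1`.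
  have hκ : ∀ θ, regressionKernel Φ σ θ = (ENNReal.ofReal Z⁻¹ • volume).withDensity
      fun y => ENNReal.ofReal (Real.exp (g θ y)) := fun θ => by
    change isoGaussian _ σ = _
    rw [(isoGaussian_eq_tilted _ hσ).2, Measure.tilted, withDensity_smul_measure,
      ← withDensity_smul' _ _ ENNReal.ofReal_ne_top]
    congr 1
    ext y
    have hZ' : ∫ y : EuclideanSpace ℝ (Fin n),
        Real.exp (-‖y - WithLp.toLp 2 (Φ *ᵥ θ.ofLp)‖ ^ 2 / (2 * σ ^ 2)) = Z :=
      integral_sub_right_eq_self (fun y : EuclideanSpace ℝ (Fin n) =>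
        Real.exp (-‖y‖ ^ 2 / (2 * σ ^ 2))) _
    rw [hZ', Pi.smul_apply, smul_eq_mul, ← ENNReal.ofReal_mul (inv_nonneg.2 hZ.le), div_eq_inv_mul]
  have hac : isoGaussian m σ ≪ (regressionKernel Φ σ) ∘ₘ
      (multivariateGaussian (0 : EuclideanSpace ℝ (Fin k)) (1 : Matrix (Fin k) (Fin k) ℝ)) := by
    refine absolutelyContinuous_comp_of_forall fun θ => ?_
    rw [(isoGaussian_eq_tilted m hσ).2]
    refine (tilted_absolutelyContinuous _ _).trans ?_
    change _ ≪ isoGaussian _ σ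
    rw [(isoGaussian_eq_tilted _ hσ).2]
    exact absolutelyContinuous_tilted (isoGaussian_eq_tilted _ hσ).1
  filter_upwards [hac.ae_le (posterior_ae_eq_tilted (regressionKernel Φ σ) _ _ g hgm hg0 hκ)]
    with y hy
  rw [coeffPosterior, hy, multivariateGaussian_zero_one, stdGaussian_eq_tilted,
    tilted_tilted (integrable_exp_neg_half_norm_sq _)]
  have hS : ((σ ^ 2) • (Φᵀ * Φ)⁻¹).PosDef := hG.inv.smul (by positivity)
  have hu : IsUnit (Φᵀ * Φ).det := hG.det_pos.ne'.isUnit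
  have hinv : ((σ ^ 2) • (Φᵀ * Φ)⁻¹)⁻¹ = (σ ^ 2)⁻¹ • (Φᵀ * Φ) := by
    refine Matrix.inv_eq_left_inv ?_
    rw [Matrix.smul_mul, Matrix.mul_smul, smul_smul, inv_mul_cancel₀ (by positivity), one_smul,
      mul_nonsing_inv _ hu]
  obtain ⟨hi, he⟩ := multivariateGaussian_eq_tilted (lsCoeff Φ y) hS
  -- The two exponents differ by the residual sum of squares over `2 * σ ^ 2`, which is constant in
  -- `θ`.
  rw [he, tilted_tilted hi, ← tilted_add_const _ ((fun z : EuclideanSpace ℝ (Fin k) => _) + _)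
    (‖y - WithLp.toLp 2 (Φ *ᵥ (lsCoeff Φ y).ofLp)‖ ^ 2 / (2 * σ ^ 2))]
  congr 1
  ext θ
  simp only [Pi.add_apply, g]
  rw [sq_norm_sub_mulVec hu, hinv, smul_mulVec, dotProduct_smul, smul_eq_mul]
  field_simp
  ring

end Regression

/-! ### Total variation cost of tilting -/

section TotalVariation

variable {α : Type*} [MeasurableSpace α]

/-- A one-sided bound suffices, since passing to the complement reverses the sign of the difference.
-/
theorem tvDist_le {μ ν : Measure α} [IsProbabilityMeasure μ] [IsProbabilityMeasure ν] {b : ℝ}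
    (h : ∀ s, MeasurableSet s → ν.real s - μ.real s ≤ b) : tvDist μ ν ≤ ENNReal.ofReal b := by
  refine iSup₂_le fun s hs => ENNReal.ofReal_le_ofReal (abs_le.2 ⟨?_, ?_⟩)
  · linarith [h s hs]
  · have h1 := h sᶜ hs.compl
    rw [probReal_compl_eq_one_sub hs, probReal_compl_eq_one_sub hs] at h1
    linarith

theorem measure_le_add_tvDist (μ ν : Measure α) [IsProbabilityMeasure μ] [IsProbabilityMeasure ν]
    {s : Set α} (hs : MeasurableSet s) : μ s ≤ ν s + tvDist μ ν := by
  have h : ENNReal.ofReal |μ.real s - ν.real s| ≤ tvDist μ ν :=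
    le_iSup₂ (f := fun (s : Set α) (_ : MeasurableSet s) => ENNReal.ofReal |μ.real s - ν.real s|) s hs
  refine le_trans ?_ (add_le_add_right h _)
  rw [← ofReal_measureReal (μ := μ), ← ofReal_measureReal (μ := ν),
    ← ENNReal.ofReal_add measureReal_nonneg (abs_nonneg _)]
  exact ENNReal.ofReal_le_ofReal (by linarith [le_abs_self (μ.real s - ν.real s)])

/-- Tilting by a small potential moves a probability measure by little in total variation. -/
theorem tvDist_tilted_le (ν : Measure α) [IsProbabilityMeasure ν] {u : α → ℝ} {c : ℝ}
    (hc : 0 ≤ c) (hu : Integrable u ν) (he : Integrable (fun x => Real.exp (-u x)) ν)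
    (hZ : ∫ x, Real.exp (-u x) ∂ν ≤ Real.exp c) :
    tvDist (ν.tilted fun x => -u x) ν ≤ ENNReal.ofReal (∫ x, |u x| ∂ν + c) := by
  have := isProbabilityMeasure_tilted he
  refine tvDist_le fun s hs => ?_
  set Z := ∫ x, Real.exp (-u x) ∂ν with hZdef
  have hZ0 : 0 < Z := integral_exp_pos he
  have hlog : Real.log Z ≤ c := (Real.log_le_iff_le_exp hZ0).2 hZ
  have h1 : (ν.tilted fun x => -u x).real s = ∫ x in s, Real.exp (-u x) / Z ∂ν := by
    rw [Measure.real, tilted_apply_eq_ofReal_integral' _ hs, ENNReal.toReal_ofReal]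
    exact integral_nonneg fun x => by positivity
  have h2 : ν.real s = ∫ x in s, (1 : ℝ) ∂ν := by simp
  have hb : Integrable (fun x => |u x| + c) ν := hu.abs.add (integrable_const c)
  rw [h1, h2, ← integral_sub (integrable_const _) (he.div_const Z).integrableOn]
  calc ∫ x in s, (1 - Real.exp (-u x) / Z) ∂ν ≤ ∫ x in s, (|u x| + c) ∂ν := by
        refine integral_mono ((integrable_const _).sub (he.div_const Z).integrableOn)
          hb.integrableOn fun x => ?_
        -- The inequality `1 - exp (-w) ≤ w` is applied with `w = u x + log Z`.
        have h3 : Real.exp (-u x) / Z = Real.exp (-u x - Real.log Z) := by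
          rw [Real.exp_sub, Real.exp_log hZ0]
        have h4 := Real.add_one_le_exp (-u x - Real.log Z)
        simp only
        rw [h3]
        linarith [le_abs_self (u x)]
    _ ≤ ∫ x, (|u x| + c) ∂ν :=
        setIntegral_le_integral hb (ae_of_all _ fun x => add_nonneg (abs_nonneg _) hc)
    _ = ∫ x, |u x| ∂ν + c := by
        rw [integral_add hu.abs (integrable_const c)]; simp

variable {ι : Type*} [Fintype ι] [DecidableEq ι] {S : Matrix ι ι ℝ}

/-- Expanding `‖x‖²` around `m` leaves the potential `u`. Dropping its quadratic part bounds `∫ exp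
(-u)` by a Gaussian exponential moment. The parameter `a` stays free because `m` will be random: it
replaces a square root of `mᵀ S m` by an expression linear in that form, which is easy to average.
-/
theorem tvDist_multivariateGaussian_tilted_le (m : EuclideanSpace ℝ ι) (hS : S.PosSemidef)
    {a : ℝ} (ha : 0 < a) :
    tvDist ((multivariateGaussian m S).tilted fun x => -‖x‖ ^ 2 / 2) (multivariateGaussian m S)
      ≤ ENNReal.ofReal (a / 2 + S.trace / 2
        + (1 / (2 * a) + 1 / 2) * (m.ofLp ⬝ᵥ (S *ᵥ m.ofLp))) := by
  set ν := multivariateGaussian m S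
  let u : EuclideanSpace ℝ ι → ℝ := fun x => inner ℝ m (x - m) + ‖x - m‖ ^ 2 / 2
  obtain ⟨he, hmgf⟩ := integral_exp_neg_inner_sub_mean m hS m
  have hsq := integrable_inner_sub_sq (S := S) m m m
  have hnorm := integrable_norm_sub_sq (S := S) m m
  have hbound : ∀ x, |u x| ≤ a / 2 + 1 / (2 * a) * (inner ℝ m (x - m)) ^ 2 + ‖x - m‖ ^ 2 / 2 := by
    intro x
    have h1 : |inner ℝ m (x - m)| ≤ a / 2 + 1 / (2 * a) * (inner ℝ m (x - m)) ^ 2 := by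
      have h2 : a / 2 + 1 / (2 * a) * (inner ℝ m (x - m)) ^ 2 - |inner ℝ m (x - m)|
          = (a - |inner ℝ m (x - m)|) ^ 2 / (2 * a) := by
        rw [← sq_abs (inner ℝ m (x - m))]
        field_simp
        ring
      have h3 : 0 ≤ (a - |inner ℝ m (x - m)|) ^ 2 / (2 * a) := by positivity
      linarith
    calc |u x| ≤ |inner ℝ m (x - m)| + |‖x - m‖ ^ 2 / 2| := abs_add_le _ _
      _ ≤ _ := by rw [abs_of_nonneg (by positivity : 0 ≤ ‖x - m‖ ^ 2 / 2)]; linarith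
  have hbi : Integrable (fun x => a / 2 + 1 / (2 * a) * (inner ℝ m (x - m)) ^ 2
      + ‖x - m‖ ^ 2 / 2) ν :=
    ((integrable_const _).add (hsq.const_mul _)).add (hnorm.div_const 2)
  have hum : Measurable u := by
    have : Continuous u := by fun_prop
    exact this.measurable
  have hu : Integrable u ν := hbi.mono' hum.aestronglyMeasurable (ae_of_all _ hbound)
  have hle : ∀ x, Real.exp (-u x) ≤ Real.exp (-inner ℝ m (x - m)) := fun x => by
    refine Real.exp_le_exp.2 ?_
    have : 0 ≤ ‖x - m‖ ^ 2 / 2 := by positivity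
    simp only [u]
    linarith
  have heu : Integrable (fun x => Real.exp (-u x)) ν :=
    he.mono' hum.neg.exp.aestronglyMeasurable (ae_of_all _ fun x => by
      rw [Real.norm_of_nonneg (Real.exp_pos _).le]; exact hle x)
  have hq : 0 ≤ m.ofLp ⬝ᵥ (S *ᵥ m.ofLp) := by
    rw [← integral_inner_sub_mean_sq m hS]
    exact integral_nonneg fun x => sq_nonneg _
  have htilt : (ν.tilted fun x => -‖x‖ ^ 2 / 2) = ν.tilted fun x => -u x := by
    rw [← tilted_add_const ν (fun x => -u x) (-‖m‖ ^ 2 / 2)]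
    congr 1
    ext x
    have h := norm_add_sq_real m (x - m)
    rw [add_sub_cancel] at h
    simp only [u]
    rw [h]
    ring
  rw [htilt]
  refine (tvDist_tilted_le ν (div_nonneg hq zero_le_two) hu heu
    ((integral_mono heu he hle).trans hmgf.le)).trans (ENNReal.ofReal_le_ofReal ?_)
  have h1 : ∫ x, |u x| ∂ν ≤ a / 2 + 1 / (2 * a) * (m.ofLp ⬝ᵥ (S *ᵥ m.ofLp)) + S.trace / 2 := by
    refine (integral_mono hu.abs hbi hbound).trans (le_of_eq ?_)
    have hi : Integrable (fun x => a / 2 + 1 / (2 * a) * (inner ℝ m (x - m)) ^ 2) ν :=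
      (integrable_const _).add (hsq.const_mul _)
    rw [integral_add hi (hnorm.div_const 2),
      integral_add (integrable_const _) (hsq.const_mul _), integral_const_mul, integral_const,
      integral_div, integral_norm_sub_mean_sq m hS, integral_inner_sub_mean_sq m hS]
    simp
  linarith

end TotalVariation

/-! ### The least squares estimator under a lower bound on the Gram matrix -/

section LeastSquares

variable {n k : ℕ} {Φ : Matrix (Fin n) (Fin k) ℝ} {σ c : ℝ}

theorem posDef_gram (hc : 0 < c)
    (hG : ∀ θ : EuclideanSpace ℝ (Fin k), c * ‖θ‖ ^ 2 ≤ θ.ofLp ⬝ᵥ ((Φᵀ * Φ) *ᵥ θ.ofLp)) :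
    (Φᵀ * Φ).PosDef := by
  refine Matrix.PosDef.of_dotProduct_mulVec_pos ?_ fun x hx => ?_
  · rw [Matrix.IsHermitian, conjTranspose_eq_transpose_of_trivial, transpose_mul,
      transpose_transpose]
  · have h := hG (WithLp.toLp 2 x)
    have h1 : 0 < ‖WithLp.toLp 2 x‖ := norm_pos_iff.2 (by simpa using hx)
    rw [star_trivial]
    exact lt_of_lt_of_le (by positivity) h

/-- For `b = (Φᵀ Φ)⁻¹ a`, the hypothesis and Cauchy-Schwarz give `c ‖b‖² ≤ ⟪b, a⟫ ≤ ‖b‖ ‖a‖`. The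
closing square avoids dividing by `‖b‖`. -/
theorem dotProduct_gram_inv_le (hc : 0 < c)
    (hG : ∀ θ : EuclideanSpace ℝ (Fin k), c * ‖θ‖ ^ 2 ≤ θ.ofLp ⬝ᵥ ((Φᵀ * Φ) *ᵥ θ.ofLp))
    (a : EuclideanSpace ℝ (Fin k)) :
    a.ofLp ⬝ᵥ ((Φᵀ * Φ)⁻¹ *ᵥ a.ofLp) ≤ ‖a‖ ^ 2 / c := by
  have hu : IsUnit (Φᵀ * Φ).det := (posDef_gram hc hG).det_pos.ne'.isUnit
  set b : EuclideanSpace ℝ (Fin k) := WithLp.toLp 2 ((Φᵀ * Φ)⁻¹ *ᵥ a.ofLp) with hb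
  have h1 : a.ofLp ⬝ᵥ ((Φᵀ * Φ)⁻¹ *ᵥ a.ofLp) = inner ℝ b a := by
    rw [EuclideanSpace.inner_eq_star_dotProduct, star_trivial]
  have h2 := hG b
  have h3 : b.ofLp ⬝ᵥ ((Φᵀ * Φ) *ᵥ b.ofLp) = inner ℝ b a := by
    rw [EuclideanSpace.inner_eq_star_dotProduct, star_trivial, hb, mulVec_mulVec,
      mul_nonsing_inv _ hu, one_mulVec, dotProduct_comm]
  rw [h3] at h2
  rw [h1, le_div_iff₀ hc]
  have h4 := real_inner_le_norm b a
  have h5 : inner ℝ b a * c ≤ ‖b‖ * c * ‖a‖ := by nlinarith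
  nlinarith [sq_nonneg (‖b‖ * c - ‖a‖)]

theorem trace_gram_inv_le (hc : 0 < c)
    (hG : ∀ θ : EuclideanSpace ℝ (Fin k), c * ‖θ‖ ^ 2 ≤ θ.ofLp ⬝ᵥ ((Φᵀ * Φ) *ᵥ θ.ofLp)) :
    (Φᵀ * Φ)⁻¹.trace ≤ k / c := by
  have h : ∀ i, (Φᵀ * Φ)⁻¹ i i ≤ 1 / c := fun i => by
    simpa using dotProduct_gram_inv_le hc hG (EuclideanSpace.single i 1)
  calc (Φᵀ * Φ)⁻¹.trace ≤ ∑ _i : Fin k, 1 / c := Finset.sum_le_sum fun i _ => h i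
    _ = k / c := by simp [div_eq_mul_inv]

theorem norm_lsCoeff_sq_le (hc : 0 < c)
    (hG : ∀ θ : EuclideanSpace ℝ (Fin k), c * ‖θ‖ ^ 2 ≤ θ.ofLp ⬝ᵥ ((Φᵀ * Φ) *ᵥ θ.ofLp))
    (y : EuclideanSpace ℝ (Fin n)) : ‖lsCoeff Φ y‖ ^ 2 ≤ ‖y‖ ^ 2 / c := by
  have hu : IsUnit (Φᵀ * Φ).det := (posDef_gram hc hG).det_pos.ne'.isUnit
  -- At `θ = 0` Pythagoras bounds the quadratic form of the Gram matrix at the estimator by `‖y‖²`.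
  have h := sq_norm_sub_mulVec hu y 0
  simp only [WithLp.ofLp_zero, mulVec_zero, WithLp.toLp_zero, sub_zero, zero_sub, WithLp.ofLp_neg,
    mulVec_neg, dotProduct_neg, neg_dotProduct, neg_neg] at h
  rw [le_div_iff₀ hc, h]
  nlinarith [hG (lsCoeff Φ y), sq_nonneg ‖y - WithLp.toLp 2 (Φ *ᵥ (lsCoeff Φ y).ofLp)‖]

@[fun_prop]
theorem continuous_lsCoeff : Continuous (lsCoeff Φ) := by
  unfold lsCoeff
  fun_prop

theorem integral_norm_sub_mean_sq_isoGaussian (hσ : 0 < σ) (m : EuclideanSpace ℝ (Fin n)) :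
    ∫ y, ‖y - m‖ ^ 2 ∂(isoGaussian m σ) = n * σ ^ 2 := by
  rw [integral_norm_sub_mean_sq m (posDef_smul_one hσ).posSemidef]
  simp [mul_comm]

theorem integral_norm_sq_isoGaussian_le (hσ : 0 < σ) (m : EuclideanSpace ℝ (Fin n)) :
    ∫ y, ‖y‖ ^ 2 ∂(isoGaussian m σ) ≤ 2 * (‖m‖ ^ 2 + n * σ ^ 2) := by
  have hi : Integrable (fun y => 2 * ‖m‖ ^ 2 + 2 * ‖y - m‖ ^ 2) (isoGaussian m σ) :=
    (integrable_const _).add ((integrable_norm_sub_sq m m).const_mul 2)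
  have h0 : Integrable (fun y => ‖y‖ ^ 2) (isoGaussian m σ) := by
    simpa using integrable_norm_sub_sq (S := (σ ^ 2) • (1 : Matrix (Fin n) (Fin n) ℝ)) m 0
  refine (integral_mono h0 hi fun y => ?_).trans (le_of_eq ?_)
  · have h1 := norm_add_le m (y - m)
    rw [add_sub_cancel] at h1
    simp only
    nlinarith [sq_nonneg (‖m‖ - ‖y - m‖), norm_nonneg y]
  · rw [integral_add (integrable_const _) ((integrable_norm_sub_sq m m).const_mul 2),
      integral_const, probReal_univ, one_smul, integral_const_mul,
      integral_norm_sub_mean_sq_isoGaussian hσ]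
    ring

theorem norm_lsCoeff_sub_sq (y m : EuclideanSpace ℝ (Fin n)) :
    ‖lsCoeff Φ y - lsCoeff Φ m‖ ^ 2
      = ∑ i, (inner ℝ (WithLp.toLp 2 fun j => ((Φᵀ * Φ)⁻¹ * Φᵀ) i j) (y - m)) ^ 2 := by
  rw [EuclideanSpace.real_norm_sq_eq]
  refine Finset.sum_congr rfl fun i _ => ?_
  rw [EuclideanSpace.inner_eq_star_dotProduct, star_trivial, dotProduct_comm]
  simp only [lsCoeff, mulVec_mulVec, ← WithLp.toLp_sub, ← mulVec_sub, ← WithLp.ofLp_sub]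
  rfl

theorem integral_norm_lsCoeff_sub_sq (hσ : 0 < σ) (hu : IsUnit (Φᵀ * Φ).det)
    (m : EuclideanSpace ℝ (Fin n)) :
    Integrable (fun y => ‖lsCoeff Φ y - lsCoeff Φ m‖ ^ 2) (isoGaussian m σ) ∧
    ∫ y, ‖lsCoeff Φ y - lsCoeff Φ m‖ ^ 2 ∂(isoGaussian m σ) = σ ^ 2 * (Φᵀ * Φ)⁻¹.trace := by
  simp_rw [norm_lsCoeff_sub_sq]
  refine ⟨integrable_finsetSum _ fun i _ => integrable_inner_sub_sq m m _, ?_⟩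
  rw [integral_finsetSum _ fun i _ => integrable_inner_sub_sq m m _, Matrix.trace, Finset.mul_sum]
  refine Finset.sum_congr rfl fun i _ => ?_
  rw [integral_inner_sub_mean_sq m (posDef_smul_one hσ).posSemidef, smul_mulVec, one_mulVec,
    dotProduct_smul, smul_eq_mul, Matrix.diag_apply]
  congr 1
  have hT : ((Φᵀ * Φ)⁻¹)ᵀ = (Φᵀ * Φ)⁻¹ := by
    rw [transpose_nonsing_inv, transpose_mul, transpose_transpose]
  -- The variance of the `i`-th coordinate is `σ²` times the squared norm of the `i`-th row of `(Φᵀ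
  -- Φ)⁻¹ Φᵀ`, that is, a diagonal entry of this product.
  have h : ((Φᵀ * Φ)⁻¹ * Φᵀ) * ((Φᵀ * Φ)⁻¹ * Φᵀ)ᵀ = (Φᵀ * Φ)⁻¹ := by
    rw [transpose_mul, transpose_transpose, hT, Matrix.mul_assoc, ← Matrix.mul_assoc Φᵀ,
      mul_nonsing_inv _ hu, Matrix.mul_one]
  conv_rhs => rw [← h]
  rfl

end LeastSquares

/-! ### Nonasymptotic bounds -/

section FiniteSample

variable {n k : ℕ} {Φ : Matrix (Fin n) (Fin k) ℝ} {σ c : ℝ}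

/-- A finite sample Bernstein-von Mises bound. -/
theorem lintegral_tvDist_coeffPosterior_le (hσ : 0 < σ) (hc : 0 < c)
    (hG : ∀ θ : EuclideanSpace ℝ (Fin k), c * ‖θ‖ ^ 2 ≤ θ.ofLp ⬝ᵥ ((Φᵀ * Φ) *ᵥ θ.ofLp))
    (m : EuclideanSpace ℝ (Fin n)) {a : ℝ} (ha : 0 < a) :
    ∫⁻ y, tvDist (coeffPosterior Φ σ y)
        (multivariateGaussian (lsCoeff Φ y) ((σ ^ 2) • (Φᵀ * Φ)⁻¹)) ∂(isoGaussian m σ)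
      ≤ ENNReal.ofReal (a / 2 + σ ^ 2 * (k / c) / 2
        + (1 / (2 * a) + 1 / 2) * (σ ^ 2 / c ^ 2 * (2 * (‖m‖ ^ 2 + n * σ ^ 2)))) := by
  have hpd := posDef_gram hc hG
  have hS : ((σ ^ 2) • (Φᵀ * Φ)⁻¹).PosSemidef := (hpd.inv.smul (by positivity)).posSemidef
  have h0 : Integrable (fun y => ‖y‖ ^ 2) (isoGaussian m σ) := by
    simpa using integrable_norm_sub_sq (S := (σ ^ 2) • (1 : Matrix (Fin n) (Fin n) ℝ)) m 0
  have hi : Integrable (fun y => a / 2 + σ ^ 2 * (k / c) / 2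
      + (1 / (2 * a) + 1 / 2) * (σ ^ 2 / c ^ 2 * ‖y‖ ^ 2)) (isoGaussian m σ) :=
    (integrable_const _).add ((h0.const_mul _).const_mul _)
  calc _ ≤ ∫⁻ y, ENNReal.ofReal (a / 2 + σ ^ 2 * (k / c) / 2
          + (1 / (2 * a) + 1 / 2) * (σ ^ 2 / c ^ 2 * ‖y‖ ^ 2)) ∂(isoGaussian m σ) := by
        refine lintegral_mono_ae ?_
        filter_upwards [coeffPosterior_ae_eq_tilted hσ hpd m] with y hy
        rw [hy]
        refine (tvDist_multivariateGaussian_tilted_le _ hS ha).trans (ENNReal.ofReal_le_ofReal ?_)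
        have h1 : ((σ ^ 2) • (Φᵀ * Φ)⁻¹).trace ≤ σ ^ 2 * (k / c) := by
          rw [trace_smul, smul_eq_mul]
          exact mul_le_mul_of_nonneg_left (trace_gram_inv_le hc hG) (by positivity)
        have h2 : (lsCoeff Φ y).ofLp ⬝ᵥ (((σ ^ 2) • (Φᵀ * Φ)⁻¹) *ᵥ (lsCoeff Φ y).ofLp)
            ≤ σ ^ 2 / c ^ 2 * ‖y‖ ^ 2 := by
          rw [smul_mulVec, dotProduct_smul, smul_eq_mul]
          calc _ ≤ σ ^ 2 * (‖y‖ ^ 2 / c / c) := by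
                refine mul_le_mul_of_nonneg_left ?_ (by positivity)
                exact (dotProduct_gram_inv_le hc hG _).trans
                  (div_le_div_of_nonneg_right (norm_lsCoeff_sq_le hc hG y) hc.le)
            _ = _ := by field_simp
        gcongr
    _ = ENNReal.ofReal (∫ y, (a / 2 + σ ^ 2 * (k / c) / 2
          + (1 / (2 * a) + 1 / 2) * (σ ^ 2 / c ^ 2 * ‖y‖ ^ 2)) ∂(isoGaussian m σ)) :=
        (ofReal_integral_eq_lintegral_ofReal hi (ae_of_all _ fun y => by positivity)).symm
    _ ≤ _ := by
        refine ENNReal.ofReal_le_ofReal ?_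
        rw [integral_add (integrable_const _) ((h0.const_mul _).const_mul _), integral_const_mul,
          integral_const_mul, integral_const, probReal_univ, one_smul]
        gcongr
        exact integral_norm_sq_isoGaussian_le hσ m

/-- Chebyshev's inequality for the approximating Gaussian. Its spread and the fluctuation of its
centre around `lsCoeff Φ m` both have mean square `σ² tr (Φᵀ Φ)⁻¹`; with `‖a + b‖² ≤ 2 ‖a‖² + 2
‖b‖²` this produces the factor `4`. -/
theorem lintegral_coeffPosterior_le (hσ : 0 < σ) (hc : 0 < c)
    (hG : ∀ θ : EuclideanSpace ℝ (Fin k), c * ‖θ‖ ^ 2 ≤ θ.ofLp ⬝ᵥ ((Φᵀ * Φ) *ᵥ θ.ofLp))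
    (m : EuclideanSpace ℝ (Fin n)) {r : ℝ} (hr : 0 < r) :
    ∫⁻ y, coeffPosterior Φ σ y {θ | r ≤ ‖θ - lsCoeff Φ m‖} ∂(isoGaussian m σ)
      ≤ ENNReal.ofReal (4 * (σ ^ 2 * (k / c)) / r ^ 2)
        + ∫⁻ y, tvDist (coeffPosterior Φ σ y)
          (multivariateGaussian (lsCoeff Φ y) ((σ ^ 2) • (Φᵀ * Φ)⁻¹)) ∂(isoGaussian m σ) := by
  have hpd := posDef_gram hc hG
  have hu : IsUnit (Φᵀ * Φ).det := hpd.det_pos.ne'.isUnit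
  have hS : ((σ ^ 2) • (Φᵀ * Φ)⁻¹).PosSemidef := (hpd.inv.smul (by positivity)).posSemidef
  have htr : σ ^ 2 * (Φᵀ * Φ)⁻¹.trace ≤ σ ^ 2 * (k / c) :=
    mul_le_mul_of_nonneg_left (trace_gram_inv_le hc hG) (by positivity)
  obtain ⟨hi, he⟩ := integral_norm_lsCoeff_sub_sq (m := m) hσ hu
  set t : EuclideanSpace ℝ (Fin n) → ℝ := fun y =>
    (2 * (σ ^ 2 * (k / c)) + 2 * ‖lsCoeff Φ y - lsCoeff Φ m‖ ^ 2) / r ^ 2 with ht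
  have hti : Integrable t (isoGaussian m σ) :=
    ((integrable_const _).add (hi.const_mul 2)).div_const _
  have hmeas : MeasurableSet {θ : EuclideanSpace ℝ (Fin k) | r ≤ ‖θ - lsCoeff Φ m‖} :=
    measurableSet_le measurable_const (by fun_prop)
  have hmarkov : ∀ y, multivariateGaussian (lsCoeff Φ y) ((σ ^ 2) • (Φᵀ * Φ)⁻¹)
      {θ | r ≤ ‖θ - lsCoeff Φ m‖} ≤ ENNReal.ofReal (t y) := fun y => by
    set ν := multivariateGaussian (lsCoeff Φ y) ((σ ^ 2) • (Φᵀ * Φ)⁻¹)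
    have hn1 := integrable_norm_sub_sq (S := (σ ^ 2) • (Φᵀ * Φ)⁻¹) (lsCoeff Φ y) (lsCoeff Φ m)
    have hn2 := integrable_norm_sub_sq (S := (σ ^ 2) • (Φᵀ * Φ)⁻¹) (lsCoeff Φ y) (lsCoeff Φ y)
    have h1 := mul_meas_ge_le_integral_of_nonneg (μ := ν)
      (ae_of_all _ fun θ => sq_nonneg ‖θ - lsCoeff Φ m‖) hn1 (r ^ 2)
    have hset : {θ : EuclideanSpace ℝ (Fin k) | r ≤ ‖θ - lsCoeff Φ m‖}
        = {θ | r ^ 2 ≤ ‖θ - lsCoeff Φ m‖ ^ 2} := by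
      ext θ
      exact (sq_le_sq₀ hr.le (norm_nonneg _)).symm
    have h2 : ∫ θ, ‖θ - lsCoeff Φ m‖ ^ 2 ∂ν
        ≤ 2 * (σ ^ 2 * (Φᵀ * Φ)⁻¹.trace) + 2 * ‖lsCoeff Φ y - lsCoeff Φ m‖ ^ 2 := by
      refine (integral_mono hn1 ((hn2.const_mul 2).add (integrable_const
        (2 * ‖lsCoeff Φ y - lsCoeff Φ m‖ ^ 2))) fun θ => ?_).trans (le_of_eq ?_)
      · have h3 := norm_add_le (θ - lsCoeff Φ y) (lsCoeff Φ y - lsCoeff Φ m)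
        rw [sub_add_sub_cancel] at h3
        simp only [Pi.add_apply]
        nlinarith [sq_nonneg (‖θ - lsCoeff Φ y‖ - ‖lsCoeff Φ y - lsCoeff Φ m‖),
          norm_nonneg (θ - lsCoeff Φ m)]
      · simp only [Pi.add_apply]
        rw [integral_add (hn2.const_mul 2) (integrable_const _), integral_const_mul,
          integral_norm_sub_mean_sq _ hS, trace_smul]
        simp
    rw [hset, ← ofReal_measureReal]
    refine ENNReal.ofReal_le_ofReal ?_
    rw [ht, le_div_iff₀ (by positivity), mul_comm]
    linarith
  calc _ ≤ ∫⁻ y, (ENNReal.ofReal (t y) + tvDist (coeffPosterior Φ σ y)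
          (multivariateGaussian (lsCoeff Φ y) ((σ ^ 2) • (Φᵀ * Φ)⁻¹))) ∂(isoGaussian m σ) :=
        lintegral_mono fun y =>
          have : IsProbabilityMeasure (coeffPosterior Φ σ y) := by
            unfold coeffPosterior; infer_instance
          (measure_le_add_tvDist _ _ hmeas).trans (add_le_add_left (hmarkov y) _)
    _ = ∫⁻ y, ENNReal.ofReal (t y) ∂(isoGaussian m σ) + _ := by
        refine lintegral_add_left ?_ _
        have : Continuous t := by fun_prop
        exact this.measurable.ennreal_ofReal
    _ ≤ _ := by
        gcongr
        rw [← ofReal_integral_eq_lintegral_ofReal hti (ae_of_all _ fun y => by positivity)]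
        refine ENNReal.ofReal_le_ofReal ?_
        rw [ht, integral_div, integral_add (integrable_const _) (hi.const_mul 2),
          integral_const, probReal_univ, one_smul, integral_const_mul, he]
        gcongr
        linarith

end FiniteSample

/-! ### Asymptotics -/

theorem tendsto_div_sqrt_of_isLittleO {k : ℕ → ℕ}
    (hk : (fun n : ℕ => (k n : ℝ)) =o[atTop]
      fun n : ℕ => ((n : ℝ) / Real.log n) ^ ((1 : ℝ) / 3)) :
    Tendsto (fun n : ℕ => (k n : ℝ) / √(n : ℝ)) atTop (𝓝 0) := by
  have h : (fun n : ℕ => ((n : ℝ) / Real.log n) ^ ((1 : ℝ) / 3)) =O[atTop]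
      fun n : ℕ => √(n : ℝ) := by
    refine IsBigO.of_bound 1 ?_
    -- From `n = 3 > e` on, `log n ≥ 1`, so the logarithm may be dropped from the denominator.
    filter_upwards [eventually_ge_atTop 3] with n hn
    have hn' : (3 : ℝ) ≤ n := by exact_mod_cast hn
    have hlog : 1 ≤ Real.log n := by
      rw [Real.le_log_iff_exp_le (by linarith)]
      linarith [Real.exp_one_lt_three]
    have h0 : 0 ≤ (n : ℝ) / Real.log n := by positivity
    rw [Real.norm_of_nonneg (by positivity), Real.norm_of_nonneg (by positivity), one_mul,
      Real.sqrt_eq_rpow]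
    calc ((n : ℝ) / Real.log n) ^ ((1 : ℝ) / 3) ≤ (n : ℝ) ^ ((1 : ℝ) / 3) :=
          Real.rpow_le_rpow h0 (div_le_self (by linarith) hlog) (by norm_num)
      _ ≤ (n : ℝ) ^ ((1 : ℝ) / 2) :=
          Real.rpow_le_rpow_of_exponent_le (by linarith) (by norm_num)
  exact (hk.trans_isBigO h).tendsto_div_nhds_zero

theorem norm_toLp_sq_le_of_abs_le {n : ℕ} {v : Fin n → ℝ} {B : ℝ} (hv : ∀ i, |v i| ≤ B) :
    ‖WithLp.toLp 2 v‖ ^ 2 ≤ n * B ^ 2 := by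
  rw [EuclideanSpace.real_norm_sq_eq]
  calc ∑ i, v i ^ 2 ≤ ∑ _i : Fin n, B ^ 2 := Finset.sum_le_sum fun i _ => by
        rw [← sq_abs]
        exact pow_le_pow_left₀ (abs_nonneg _) (hv i) 2
    _ = n * B ^ 2 := by simp

theorem proposition7
    (σ : ℝ) (hσ : 0 < σ)
    (q : ℕ) (hq : 1 ≤ q)
    (f : unitInterval → ℝ) (hf : ∃ B : ℝ, ∀ u, |f u| ≤ B)
    (x : (n : ℕ) → Fin n → unitInterval)
    (k : ℕ → ℕ) (hqk : ∀ᶠ n in atTop, q ≤ k n)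
    (hk : (fun n : ℕ => (k n : ℝ)) =o[atTop]
      fun n : ℕ => ((n : ℝ) / Real.log n) ^ ((1 : ℝ) / 3))
    (hdesign : ∃ C₁ > (0 : ℝ), ∃ C₂ > (0 : ℝ), ∀ᶠ n in atTop,
      ∀ θ : EuclideanSpace ℝ (Fin (k n)),
        C₁ * ((n : ℝ) / k n) * ‖θ‖ ^ 2
            ≤ θ.ofLp ⬝ᵥ (((splineMatrix q (k n) (x n))ᵀ * splineMatrix q (k n) (x n)) *ᵥ θ.ofLp) ∧
        θ.ofLp ⬝ᵥ (((splineMatrix q (k n) (x n))ᵀ * splineMatrix q (k n) (x n)) *ᵥ θ.ofLp)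
            ≤ C₂ * ((n : ℝ) / k n) * ‖θ‖ ^ 2) :
    Tendsto (fun n : ℕ =>
        ∫⁻ y, tvDist (coeffPosterior (splineMatrix q (k n) (x n)) σ y)
            (multivariateGaussian (lsCoeff (splineMatrix q (k n) (x n)) y)
              ((σ ^ 2) • ((splineMatrix q (k n) (x n))ᵀ * splineMatrix q (k n) (x n))⁻¹))
          ∂(isoGaussian (WithLp.toLp 2 fun i => f (x n i)) σ))
      atTop (𝓝 0) ∧
    ∀ l : ℕ → ℝ, Tendsto l atTop atTop →
      Tendsto (fun n : ℕ =>
          ∫⁻ y, coeffPosterior (splineMatrix q (k n) (x n)) σ y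
              {θ | l n * ((k n : ℝ) / √(n : ℝ))
                ≤ ‖θ - lsCoeff (splineMatrix q (k n) (x n))
                    (WithLp.toLp 2 fun i => f (x n i))‖}
            ∂(isoGaussian (WithLp.toLp 2 fun i => f (x n i)) σ))
        atTop (𝓝 0) := by
  obtain ⟨B, hB⟩ := hf
  obtain ⟨C₁, hC₁, C₂, -, hd⟩ := hdesign
  have hr := tendsto_div_sqrt_of_isLittleO hk
  set r : ℕ → ℝ := fun n => (k n : ℝ) / √(n : ℝ) with hrdef
  have hpos : ∀ᶠ n : ℕ in atTop, 0 < (n : ℝ) ∧ 0 < (k n : ℝ) := by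
    filter_upwards [eventually_gt_atTop 0, hqk] with n hn hq'
    exact ⟨by exact_mod_cast hn, by exact_mod_cast lt_of_lt_of_le hq hq'⟩
  have hr2 : ∀ n : ℕ, r n ^ 2 = (k n : ℝ) ^ 2 / n := fun n => by
    rw [hrdef, div_pow, Real.sq_sqrt (Nat.cast_nonneg n)]
  have hkc : ∀ n : ℕ, (k n : ℝ) / (C₁ * ((n : ℝ) / k n)) = r n ^ 2 / C₁ := fun n => by
    rw [hr2, ← div_div, div_div_eq_mul_div]
    ring
  have h1 : Tendsto (fun n : ℕ =>
      ∫⁻ y, tvDist (coeffPosterior (splineMatrix q (k n) (x n)) σ y)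
          (multivariateGaussian (lsCoeff (splineMatrix q (k n) (x n)) y)
            ((σ ^ 2) • ((splineMatrix q (k n) (x n))ᵀ * splineMatrix q (k n) (x n))⁻¹))
        ∂(isoGaussian (WithLp.toLp 2 fun i => f (x n i)) σ)) atTop (𝓝 0) := by
    -- `D * r n ^ 2` is the value of `σ² / c² * 2 (n B² + n σ²)` at `c = C₁ n / k n`; it dominates
    -- the mean of `θ_Yᵀ S θ_Y`.
    set D : ℝ := 2 * σ ^ 2 * (B ^ 2 + σ ^ 2) / C₁ ^ 2 with hD
    have hlim : Tendsto (fun n => ENNReal.ofReal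
        (r n / 2 + σ ^ 2 * (r n ^ 2 / C₁) / 2 + (D * r n / 2 + D * r n ^ 2 / 2)))
        atTop (𝓝 0) := by
      have hc : Continuous fun t : ℝ =>
        t / 2 + σ ^ 2 * (t ^ 2 / C₁) / 2 + (D * t / 2 + D * t ^ 2 / 2) := by fun_prop
      have h := ENNReal.tendsto_ofReal ((hc.tendsto 0).comp hr)
      simpa [Function.comp_def] using h
    refine tendsto_of_tendsto_of_tendsto_of_le_of_le' tendsto_const_nhds hlim
      (Eventually.of_forall fun _ => zero_le) ?_
    filter_upwards [hpos, hd] with n ⟨hn, hkn⟩ hdn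
    have hrn : 0 < r n := by simp only [hrdef]; positivity
    -- The choice `a = r n` balances `a / 2` against `D * r n ^ 2 / (2 * a)`: both are of order `r
    -- n`.
    refine (lintegral_tvDist_coeffPosterior_le hσ (c := C₁ * ((n : ℝ) / k n)) (by positivity)
      (fun θ => (hdn θ).1) _ hrn).trans (ENNReal.ofReal_le_ofReal ?_)
    have hm : ‖WithLp.toLp 2 fun i => f (x n i)‖ ^ 2 ≤ n * B ^ 2 :=
      norm_toLp_sq_le_of_abs_le fun i => hB (x n i)
    rw [hkc]
    have h2 : σ ^ 2 / (C₁ * ((n : ℝ) / k n)) ^ 2 *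
        (2 * (‖WithLp.toLp 2 fun i => f (x n i)‖ ^ 2 + n * σ ^ 2)) ≤ D * r n ^ 2 := by
      calc _ ≤ σ ^ 2 / (C₁ * ((n : ℝ) / k n)) ^ 2 * (2 * (n * B ^ 2 + n * σ ^ 2)) := by gcongr
        _ = D * r n ^ 2 := by
          rw [hr2, hD]
          field_simp
    have h3 : (1 / (2 * r n) + 1 / 2) * (D * r n ^ 2) = D * r n / 2 + D * r n ^ 2 / 2 := by
      field_simp
    rw [← h3]
    gcongr
  refine ⟨h1, fun l hl => ?_⟩
  have h2 : Tendsto (fun n => ENNReal.ofReal (4 * (σ ^ 2 / C₁) / l n ^ 2)) atTop (𝓝 0) := by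
    have h := (tendsto_const_nhds (x := 4 * (σ ^ 2 / C₁))).div_atTop
      ((tendsto_pow_atTop two_ne_zero).comp hl)
    simpa using ENNReal.tendsto_ofReal h
  have h3 := h2.add h1
  rw [add_zero] at h3
  refine tendsto_of_tendsto_of_tendsto_of_le_of_le' tendsto_const_nhds h3
    (Eventually.of_forall fun _ => zero_le) ?_
  filter_upwards [hpos, hd, hl.eventually_gt_atTop 0] with n ⟨hn, hkn⟩ hdn hln
  have hrn : 0 < r n := by simp only [hrdef]; positivity
  refine (lintegral_coeffPosterior_le hσ (c := C₁ * ((n : ℝ) / k n)) (by positivity)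
    (fun θ => (hdn θ).1) _ (mul_pos hln hrn)).trans ?_
  -- The trace bound is exactly of order `r n ^ 2`, so the rate cancels and only `l n` remains.
  have h4 : 4 * (σ ^ 2 * (r n ^ 2 / C₁)) / (l n * r n) ^ 2 = 4 * (σ ^ 2 / C₁) / l n ^ 2 := by
    field_simp
  rw [hkc]
  change ENNReal.ofReal (4 * (σ ^ 2 * (r n ^ 2 / C₁)) / (l n * r n) ^ 2) + _ ≤ _
  rw [h4]
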